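/- Let $d\ge 1$ and $k\ge 0$ be integers and let $p>1$ be real. For $Q\in \mathrm{SO}(d-1)$ write $\tilde Q=\begin{pmatrix}1&0\\0&Q\end{pmatrix}\in\mathbb R^{d\times d}$ ($\mathrm{SO}(0)$ being the trivial group). Let $G=(\mathbb R_+\times \mathrm{SO}(d-1))\ltimes\mathbb R^d$ be the set of triples $g=(\alpha,Q,b)$ with $\alpha>0$, $Q\in\mathrm{SO}(d-1)$, $b\in\mathbb R^d$, with the product topology and the group law $$(\alpha_1,Q_1,b_1)\bullet(\alpha_2,Q_2,b_2)=\bigl(\alpha_1\alpha_2,\;Q_1Q_2,\;b_1+\alpha_1^{p-1}\tilde Q_1b_2\bigr),$$ whose unit is $\mathbb 1=(1,I,0)$. For $v:\mathbb R^d\to\mathbb R$ put $$[a(\alpha,Q,b)v](x)=\alpha^{-1}\,v\bigl(\alpha^{1-p}\tilde Q^{\top}(x-b)\bigr),\qquad x\in\mathbb R^d .$$ Let $X$ be one of the following two spaces of real-valued functions on $\mathbb R^d$: * $X=\mathcal C^k_0(\mathbb R^d)$, the $k$-times continuously differentiable $u$ with $D^\beta u(x)\to0$ as $|x|\to\infty$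 for all multi-indices $|\beta|\le k$, with norm $\|u\|=\max_{|\beta|\le k}\|D^\beta u\|_\infty$; * $X=H^k(\mathbb R^d)$, the $u\in L^2(\mathbb R^d)$ whose weak derivatives $D^\beta u$, $|\beta|\le k$, all exist in $L^2(\mathbb R^d)$, with norm $\|u\|^2=\sum_{|\beta|\le k}\|D^\beta u\|_{L^2}^2$ (here the formula for $a(g)v$ is understood almost everywhere). Then $a$ is a strongly continuous linear action of $G$ on $X$, that is: 1. for every $g\in G$, $a(g)$ maps $X$ to $X$ and belongs to $\mathrm{GL}(X)$, i.e. it is a bounded linear bijection of $X$ with bounded inverse; 2. $a(\mathbb 1)=\mathrm{id}_X$; 3. $a(g\bullet h)=a(g)\circ a(h)$ for all $g,h\in G$; 4. $\lim_{g\to\mathbb 1}a(g)v=v$ in $X$ for every $v\in X$. Moreover, the map $G\times X\to X$, $(g,v)\mapsto a(g)v$, is continuous. -/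

import Mathlib

open MeasureTheory Filter Topology
open scoped ContDiff

/-- Euclidean space `ℝᵈ`. -/
abbrev Rd (d : ℕ) : Type := EuclideanSpace ℝ (Fin d)

/-! ### The symmetry group `G = (ℝ₊ × SO(d - 1)) ⋉ ℝᵈ`, written with `d = n + 1` -/

namespace Burgers

/-- The augmented matrix `Q̃ = (1 0; 0 Q)`. -/
def aug {n : ℕ} (Q : Matrix (Fin n) (Fin n) ℝ) : Matrix (Fin (n + 1)) (Fin (n + 1)) ℝ :=
  Matrix.of (Fin.cons (Fin.cons 1 0) (fun i => Fin.cons 0 (Q i)))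

theorem aug_one {n : ℕ} : aug (1 : Matrix (Fin n) (Fin n) ℝ) = 1 := by
  ext i j
  refine Fin.cases ?_ (fun i => ?_) i <;> refine Fin.cases ?_ (fun j => ?_) j <;>
    simp [aug, Matrix.one_apply, Fin.succ_ne_zero, (Fin.succ_ne_zero _).symm]

theorem aug_mul {n : ℕ} (P Q : Matrix (Fin n) (Fin n) ℝ) : aug (P * Q) = aug P * aug Q := by
  ext i j
  refine Fin.cases ?_ (fun i => ?_) i <;> refine Fin.cases ?_ (fun j => ?_) j <;>
    simp [aug, Matrix.mul_apply, Fin.sum_univ_succ]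

/-- A matrix acting on Euclidean space by matrix-vector multiplication. -/
noncomputable def mulV {d : ℕ} (A : Matrix (Fin d) (Fin d) ℝ) (x : Rd d) : Rd d :=
  WithLp.toLp 2 (A.mulVec x.ofLp)

theorem mulV_one {d : ℕ} (x : Rd d) : mulV 1 x = x := by simp [mulV]

theorem mulV_mulV {d : ℕ} (A B : Matrix (Fin d) (Fin d) ℝ) (x : Rd d) :
    mulV A (mulV B x) = mulV (A * B) x := by simp [mulV]

theorem mulV_add {d : ℕ} (A : Matrix (Fin d) (Fin d) ℝ) (x y : Rd d) :
    mulV A (x + y) = mulV A x + mulV A y := by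
  simp [mulV, Matrix.mulVec_add]

theorem mulV_smul {d : ℕ} (A : Matrix (Fin d) (Fin d) ℝ) (c : ℝ) (x : Rd d) :
    mulV A (c • x) = c • mulV A x := by
  simp [mulV, Matrix.mulVec_smul]

/-- The elements `g = (α, Q, b)` of `G`, with `α > 0`, `Q ∈ SO(d - 1)`, `b ∈ ℝᵈ`, `d = n + 1`.
The exponent `p` is a parameter of the type because the group law depends on it. -/
@[ext]
structure G (n : ℕ) (p : ℝ) where
  α : {a : ℝ // 0 < a}
  Q : Matrix.specialOrthogonalGroup (Fin n) ℝ
  b : Rd (n + 1)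

namespace G

variable {n : ℕ} {p : ℝ}

/-- The unit `(1, I, 0)`. -/
instance : One (G n p) := ⟨⟨1, 1, 0⟩⟩

/-- The composition law of the affine maps `x ↦ α ^ (p - 1) Q̃ x + b`:
`(α₁, Q₁, b₁) (α₂, Q₂, b₂) = (α₁ α₂, Q₁ Q₂, b₁ + α₁ ^ (p - 1) Q̃₁ b₂)`. -/
noncomputable instance : Mul (G n p) :=
  ⟨fun g h => ⟨g.α * h.α, g.Q * h.Q, g.b + (g.α : ℝ) ^ (p - 1) • mulV (aug g.Q.1) h.b⟩⟩

noncomputable instance : Inv (G n p) :=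
  ⟨fun g => ⟨g.α⁻¹, g.Q⁻¹, -((g.α⁻¹ : {a : ℝ // 0 < a}) : ℝ) ^ (p - 1) •
    mulV (aug (g.Q⁻¹).1) g.b⟩⟩

theorem one_def : (1 : G n p) = ⟨1, 1, 0⟩ := rfl

theorem mul_def (g h : G n p) :
    g * h = ⟨g.α * h.α, g.Q * h.Q, g.b + (g.α : ℝ) ^ (p - 1) • mulV (aug g.Q.1) h.b⟩ := rfl

theorem inv_def (g : G n p) :
    g⁻¹ = ⟨g.α⁻¹, g.Q⁻¹, -((g.α⁻¹ : {a : ℝ // 0 < a}) : ℝ) ^ (p - 1) •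
      mulV (aug (g.Q⁻¹).1) g.b⟩ := rfl

noncomputable instance : Group (G n p) :=
  Group.ofLeftAxioms
    (by
      intro g h k
      simp only [mul_def, G.mk.injEq]
      refine ⟨mul_assoc _ _ _, mul_assoc _ _ _, ?_⟩
      rw [mulV_add, mulV_smul, mulV_mulV, smul_add, smul_smul, ← add_assoc]
      congr 2
      · rw [Positive.val_mul, Real.mul_rpow g.α.2.le h.α.2.le]
      · rw [Submonoid.coe_mul, aug_mul])
    (by
      intro g
      simp [mul_def, one_def, aug_one, mulV_one])
    (by
      intro g
      simp [mul_def, inv_def, one_def])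

/-- The topology of `G` is the product topology of `ℝ₊ × SO(d - 1) × ℝᵈ`. -/
instance : TopologicalSpace (G n p) :=
  TopologicalSpace.induced (fun g : G n p => (g.α, g.Q, g.b)) inferInstance

end G

/-- The action on functions, `(a(α, Q, b) v)(x) = α⁻¹ v(α ^ (1 - p) Q̃ᵀ (x - b))`. -/
noncomputable def act {n : ℕ} {p : ℝ} (g : G n p) (v : Rd (n + 1) → ℝ) : Rd (n + 1) → ℝ :=
  fun x => (g.α : ℝ)⁻¹ *
    v ((g.α : ℝ) ^ (1 - p) • mulV (aug g.Q.1).transpose (x - g.b))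

end Burgers

/-! ### Partial derivatives and multi-indices -/

/-- The partial derivative `∂ᵢ u`. -/
noncomputable def pderiv {d : ℕ} (i : Fin d) (u : Rd d → ℝ) : Rd d → ℝ :=
  fun x => fderiv ℝ u x (EuclideanSpace.single i 1)

/-- Composition of the operators `∂ᵢ ^ βᵢ` for `i` running through a list. -/
noncomputable def listDeriv {d : ℕ} (β : Fin d → ℕ) (l : List (Fin d)) (u : Rd d → ℝ) :
    Rd d → ℝ :=
  l.foldr (fun i w => (pderiv i)^[β i] w) u

/-- The derivative `D^β u = ∂₁ ^ β₁ ⋯ ∂_d ^ β_d u`. -/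
noncomputable def multiDeriv {d : ℕ} (β : Fin d → ℕ) (u : Rd d → ℝ) : Rd d → ℝ :=
  listDeriv β (List.finRange d) u

/-- The multi-indices `β ∈ ℕᵈ` with `|β| ≤ k`. -/
def MultiIndex (d k : ℕ) : Type := {β : Fin d → ℕ // ∑ i, β i ≤ k}

noncomputable instance (d k : ℕ) : Fintype (MultiIndex d k) :=
  Fintype.ofInjective
    (fun β : MultiIndex d k => fun i : Fin d =>
      (⟨β.1 i, Nat.lt_succ_of_le ((Finset.single_le_sum (f := β.1)
        (fun _ _ => Nat.zero_le _) (Finset.mem_univ i)).trans β.2)⟩ : Fin (k + 1)))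
    (by
      intro β γ h
      apply Subtype.ext
      funext i
      exact congrArg Fin.val (congrFun h i))

/-- The zero multi-index. -/
def MultiIndex.zero (d k : ℕ) : MultiIndex d k := ⟨0, by simp⟩

section Calculus

variable {d : ℕ}

theorem pderiv_contDiff {m : ℕ} (i : Fin d) {u : Rd d → ℝ}
    (hu : ContDiff ℝ ((m + 1 : ℕ) : WithTop ℕ∞) u) : ContDiff ℝ (m : WithTop ℕ∞) (pderiv i u) :=
  (hu.fderiv_right (by norm_cast)).clm_apply contDiff_const

theorem pderiv_add (i : Fin d) {u w : Rd d → ℝ} (hu : Differentiable ℝ u)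
    (hw : Differentiable ℝ w) : pderiv i (u + w) = pderiv i u + pderiv i w := by
  funext x
  simp [pderiv, fderiv_add (hu x) (hw x)]

theorem pderiv_smul (i : Fin d) (c : ℝ) (u : Rd d → ℝ) : pderiv i (c • u) = c • pderiv i u := by
  funext x
  simp [pderiv, fderiv_const_smul_field]

theorem pderiv_iterate_contDiff (i : Fin d) (r : ℕ) : ∀ {m : ℕ} {u : Rd d → ℝ},
    ContDiff ℝ ((m + r : ℕ) : WithTop ℕ∞) u →
      ContDiff ℝ (m : WithTop ℕ∞) ((pderiv i)^[r] u) := by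
  induction r with
  | zero => intro m u hu; simpa using hu
  | succ r ih =>
    intro m u hu
    rw [Function.iterate_succ_apply]
    exact ih (pderiv_contDiff i (by simpa [add_assoc] using hu))

theorem pderiv_iterate_add (i : Fin d) (r : ℕ) : ∀ {u w : Rd d → ℝ},
    ContDiff ℝ (r : WithTop ℕ∞) u → ContDiff ℝ (r : WithTop ℕ∞) w →
      (pderiv i)^[r] (u + w) = (pderiv i)^[r] u + (pderiv i)^[r] w := by
  induction r with
  | zero => intro u w _ _; rfl
  | succ r ih =>
    intro u w hu hw
    have h : ((r + 1 : ℕ) : WithTop ℕ∞) ≠ 0 := by exact_mod_cast Nat.succ_ne_zero r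
    rw [Function.iterate_succ_apply, pderiv_add i (hu.differentiable h) (hw.differentiable h),
      ih (pderiv_contDiff i hu) (pderiv_contDiff i hw)]
    rfl

theorem pderiv_iterate_smul (i : Fin d) (c : ℝ) (u : Rd d → ℝ) (r : ℕ) :
    (pderiv i)^[r] (c • u) = c • (pderiv i)^[r] u := by
  induction r with
  | zero => rfl
  | succ r ih => rw [Function.iterate_succ_apply', ih, pderiv_smul, Function.iterate_succ_apply']

theorem listDeriv_contDiff (β : Fin d → ℕ) (l : List (Fin d)) : ∀ {m : ℕ} {u : Rd d → ℝ},
    ContDiff ℝ ((m + (l.map β).sum : ℕ) : WithTop ℕ∞) u →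
      ContDiff ℝ (m : WithTop ℕ∞) (listDeriv β l u) := by
  induction l with
  | nil => intro m u hu; simpa [listDeriv] using hu
  | cons i l ih =>
    intro m u hu
    exact pderiv_iterate_contDiff i (β i) (ih (by simpa [add_assoc] using hu))

theorem listDeriv_add (β : Fin d → ℕ) (l : List (Fin d)) {u w : Rd d → ℝ}
    (hu : ContDiff ℝ ((l.map β).sum : WithTop ℕ∞) u)
    (hw : ContDiff ℝ ((l.map β).sum : WithTop ℕ∞) w) :
    listDeriv β l (u + w) = listDeriv β l u + listDeriv β l w := by
  induction l with
  | nil => rfl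
  | cons i l ih =>
    have hl : ((l.map β).sum : WithTop ℕ∞) ≤ (((i :: l).map β).sum : ℕ) := by
      norm_cast; simp
    have h := ih (hu.of_le hl) (hw.of_le hl)
    have e : ∀ v : Rd d → ℝ, listDeriv β (i :: l) v = (pderiv i)^[β i] (listDeriv β l v) :=
      fun _ => rfl
    rw [e, e, e, h]
    exact pderiv_iterate_add i (β i) (listDeriv_contDiff β l (by simpa using hu))
      (listDeriv_contDiff β l (by simpa using hw))

theorem listDeriv_smul (β : Fin d → ℕ) (l : List (Fin d)) (c : ℝ) (u : Rd d → ℝ) :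
    listDeriv β l (c • u) = c • listDeriv β l u := by
  induction l with
  | nil => rfl
  | cons i l ih =>
    have e : ∀ v : Rd d → ℝ, listDeriv β (i :: l) v = (pderiv i)^[β i] (listDeriv β l v) :=
      fun _ => rfl
    rw [e, e, ih, pderiv_iterate_smul]

theorem sum_map_finRange (β : Fin d → ℕ) : ((List.finRange d).map β).sum = ∑ i, β i :=
  (Fin.sum_univ_def β).symm

theorem multiDeriv_contDiff (β : Fin d → ℕ) {m : ℕ} {u : Rd d → ℝ}
    (hu : ContDiff ℝ ((m + ∑ i, β i : ℕ) : WithTop ℕ∞) u) :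
    ContDiff ℝ (m : WithTop ℕ∞) (multiDeriv β u) :=
  listDeriv_contDiff β _ (by rwa [sum_map_finRange])

theorem multiDeriv_add (β : Fin d → ℕ) {u w : Rd d → ℝ}
    (hu : ContDiff ℝ ((∑ i, β i : ℕ) : WithTop ℕ∞) u)
    (hw : ContDiff ℝ ((∑ i, β i : ℕ) : WithTop ℕ∞) w) :
    multiDeriv β (u + w) = multiDeriv β u + multiDeriv β w :=
  listDeriv_add β _ (by rwa [sum_map_finRange]) (by rwa [sum_map_finRange])

theorem multiDeriv_smul (β : Fin d → ℕ) (c : ℝ) (u : Rd d → ℝ) :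
    multiDeriv β (c • u) = c • multiDeriv β u :=
  listDeriv_smul β _ c u

theorem multiDeriv_zero (u : Rd d → ℝ) : multiDeriv (0 : Fin d → ℕ) u = u := by
  unfold multiDeriv
  induction List.finRange d with
  | nil => rfl
  | cons i l ih => exact ih

end Calculus

/-! ### The space `C₀ᵏ(ℝᵈ)` -/

/-- The `k` times continuously differentiable functions on `ℝᵈ` all of whose derivatives of order
at most `k` vanish at infinity. -/
noncomputable def c0Submodule (d k : ℕ) : Submodule ℝ (Rd d → ℝ) where
  carrier := {u | ContDiff ℝ (k : WithTop ℕ∞) u ∧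
    ∀ β : MultiIndex d k, Tendsto (multiDeriv β.1 u) (cocompact (Rd d)) (𝓝 0)}
  add_mem' := by
    rintro u w ⟨hu, hu'⟩ ⟨hw, hw'⟩
    refine ⟨hu.add hw, fun β => ?_⟩
    have hβ : ((∑ i, β.1 i : ℕ) : WithTop ℕ∞) ≤ (k : WithTop ℕ∞) := by exact_mod_cast β.2
    rw [multiDeriv_add β.1 (hu.of_le hβ) (hw.of_le hβ)]
    have h := (hu' β).add (hw' β)
    rw [add_zero] at h
    exact h
  zero_mem' := by
    refine ⟨contDiff_const, fun β => ?_⟩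
    have h := multiDeriv_smul β.1 0 (0 : Rd d → ℝ)
    rw [zero_smul, zero_smul] at h
    rw [h]
    exact tendsto_const_nhds
  smul_mem' := by
    rintro c u ⟨hu, hu'⟩
    refine ⟨contDiff_const.smul hu, fun β => ?_⟩
    rw [multiDeriv_smul]
    have h := (hu' β).const_smul c
    rw [smul_zero] at h
    exact h

/-- The space `C₀ᵏ(ℝᵈ)`. -/
def C0 (d k : ℕ) : Type := c0Submodule d k

namespace C0

variable {d k : ℕ}

noncomputable instance : AddCommGroup (C0 d k) := inferInstanceAs (AddCommGroup (c0Submodule d k))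
noncomputable instance : Module ℝ (C0 d k) := inferInstanceAs (Module ℝ (c0Submodule d k))

instance : CoeFun (C0 d k) (fun _ => Rd d → ℝ) := ⟨fun u => u.1⟩

theorem contDiff_multiIndex (u : C0 d k) (β : MultiIndex d k) :
    ContDiff ℝ ((∑ i, β.1 i : ℕ) : WithTop ℕ∞) (u : Rd d → ℝ) :=
  u.2.1.of_le (by exact_mod_cast β.2)

/-- `D^β u` as a continuous function vanishing at infinity. -/
noncomputable def deriv (u : C0 d k) (β : MultiIndex d k) : ZeroAtInftyContinuousMap (Rd d) ℝ where
  toFun := multiDeriv β.1 u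
  continuous_toFun :=
    (multiDeriv_contDiff (m := 0) β.1 (by simpa using u.contDiff_multiIndex β)).continuous
  zero_at_infty' := u.2.2 β

/-- The family `(D^β u)` of all derivatives of order at most `k`. -/
noncomputable def derivs :
    C0 d k →ₗ[ℝ] (MultiIndex d k → ZeroAtInftyContinuousMap (Rd d) ℝ) where
  toFun u β := u.deriv β
  map_add' u w := by
    funext β
    ext x
    exact congrFun (multiDeriv_add β.1 (u.contDiff_multiIndex β) (w.contDiff_multiIndex β)) x
  map_smul' c u := by
    funext β
    ext x
    exact congrFun (multiDeriv_smul β.1 c (u : Rd d → ℝ)) x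

theorem derivs_injective : Function.Injective (derivs (d := d) (k := k)) := by
  intro u w h
  apply Subtype.ext
  have h0 : multiDeriv (0 : Fin d → ℕ) (u : Rd d → ℝ) = multiDeriv 0 (w : Rd d → ℝ) :=
    congrArg DFunLike.coe (congrFun h (MultiIndex.zero d k))
  rwa [multiDeriv_zero, multiDeriv_zero] at h0

/-- The norm `‖u‖ = max_{|β| ≤ k} ‖D^β u‖_∞`. -/
noncomputable instance : NormedAddCommGroup (C0 d k) :=
  NormedAddCommGroup.induced (C0 d k) (MultiIndex d k → ZeroAtInftyContinuousMap (Rd d) ℝ)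
    derivs derivs_injective

noncomputable instance : NormedSpace ℝ (C0 d k) :=
  NormedSpace.induced ℝ (C0 d k) (MultiIndex d k → ZeroAtInftyContinuousMap (Rd d) ℝ) derivs

theorem norm_def (u : C0 d k) :
    ‖u‖ = ((Finset.univ.sup fun β => ‖u.deriv β‖₊ : NNReal) : ℝ) := rfl

end C0

/-! ### The Sobolev space `Hᵏ(ℝᵈ)` -/

/-- `w` is the weak derivative `D^β u`. -/
def IsWeakDeriv {d : ℕ} (β : Fin d → ℕ) (u w : Lp ℝ 2 (volume : Measure (Rd d))) : Prop :=
  ∀ φ : Rd d → ℝ, ContDiff ℝ ∞ φ → HasCompactSupport φ →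
    ∫ x, u x * multiDeriv β φ x = (-1) ^ (∑ i, β i) * ∫ x, w x * φ x

section Weak

variable {d : ℕ}

theorem pderiv_iterate_hasCompactSupport (i : Fin d) (r : ℕ) {φ : Rd d → ℝ}
    (hφ : HasCompactSupport φ) : HasCompactSupport ((pderiv i)^[r] φ) := by
  induction r with
  | zero => exact hφ
  | succ r ih => rw [Function.iterate_succ_apply']; exact ih.fderiv_apply ℝ _

theorem multiDeriv_hasCompactSupport (β : Fin d → ℕ) {φ : Rd d → ℝ}
    (hφ : HasCompactSupport φ) : HasCompactSupport (multiDeriv β φ) := by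
  unfold multiDeriv
  induction List.finRange d with
  | nil => exact hφ
  | cons i l ih => exact pderiv_iterate_hasCompactSupport i (β i) ih

theorem Lp_integrable_mul (u : Lp ℝ 2 (volume : Measure (Rd d))) {φ : Rd d → ℝ}
    (hc : Continuous φ) (hφ : HasCompactSupport φ) : Integrable (fun x => u x * φ x) :=
  (Lp.memLp u).integrable_mul (hc.memLp_of_hasCompactSupport (p := 2) hφ)

theorem multiDeriv_continuous (β : Fin d → ℕ) {φ : Rd d → ℝ} (hφ : ContDiff ℝ ∞ φ) :
    Continuous (multiDeriv β φ) :=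
  (multiDeriv_contDiff (m := 0) β (hφ.of_le (by exact_mod_cast le_top))).continuous

theorem IsWeakDeriv.add {β : Fin d → ℕ} {u u' w w' : Lp ℝ 2 (volume : Measure (Rd d))}
    (h : IsWeakDeriv β u w) (h' : IsWeakDeriv β u' w') : IsWeakDeriv β (u + u') (w + w') := by
  intro φ hφ hc
  have key : ∀ (f g : Lp ℝ 2 (volume : Measure (Rd d))) (ψ : Rd d → ℝ), Continuous ψ →
      HasCompactSupport ψ →
      ∫ x, (f + g : Lp ℝ 2 (volume : Measure (Rd d))) x * ψ x
        = (∫ x, f x * ψ x) + ∫ x, g x * ψ x := by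
    intro f g ψ h1 h2
    rw [← integral_add (Lp_integrable_mul f h1 h2) (Lp_integrable_mul g h1 h2)]
    refine integral_congr_ae ?_
    filter_upwards [Lp.coeFn_add f g] with x hx
    rw [hx, Pi.add_apply, add_mul]
  rw [key _ _ _ (multiDeriv_continuous β hφ) (multiDeriv_hasCompactSupport β hc),
    key _ _ _ hφ.continuous hc, h φ hφ hc, h' φ hφ hc, mul_add]

theorem IsWeakDeriv.smul {β : Fin d → ℕ} {u w : Lp ℝ 2 (volume : Measure (Rd d))} (c : ℝ)
    (h : IsWeakDeriv β u w) : IsWeakDeriv β (c • u) (c • w) := by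
  intro φ hφ hc
  have key : ∀ (f : Lp ℝ 2 (volume : Measure (Rd d))) (ψ : Rd d → ℝ),
      ∫ x, (c • f : Lp ℝ 2 (volume : Measure (Rd d))) x * ψ x = c * ∫ x, f x * ψ x := by
    intro f ψ
    rw [← integral_const_mul]
    refine integral_congr_ae ?_
    filter_upwards [Lp.coeFn_smul c f] with x hx
    rw [hx, Pi.smul_apply, smul_eq_mul, mul_assoc]
  rw [key, key, h φ hφ hc]
  ring

theorem isWeakDeriv_zero_index (u : Lp ℝ 2 (volume : Measure (Rd d))) :
    IsWeakDeriv (0 : Fin d → ℕ) u u := by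
  intro φ _ _
  simp [multiDeriv_zero]

theorem IsWeakDeriv.unique {β : Fin d → ℕ} {u w w' : Lp ℝ 2 (volume : Measure (Rd d))}
    (h : IsWeakDeriv β u w) (h' : IsWeakDeriv β u w') : w = w' := by
  apply Lp.ext
  refine ae_eq_of_integral_contDiff_smul_eq
    ((Lp.memLp w).locallyIntegrable (by norm_num))
    ((Lp.memLp w').locallyIntegrable (by norm_num)) fun φ hφ hc => ?_
  have e := (h φ hφ hc).symm.trans (h' φ hφ hc)
  have e' := mul_left_cancel₀ (pow_ne_zero _ (by norm_num)) e
  simpa [mul_comm] using e'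

end Weak

/-- The functions in `L²(ℝᵈ)` all of whose weak derivatives of order at most `k` exist in
`L²(ℝᵈ)`. -/
noncomputable def sobolevSubmodule (d k : ℕ) :
    Submodule ℝ (Lp ℝ 2 (volume : Measure (Rd d))) where
  carrier := {u | ∀ β : MultiIndex d k,
    ∃ w : Lp ℝ 2 (volume : Measure (Rd d)), IsWeakDeriv β.1 u w}
  add_mem' := by
    intro u u' hu hu' β
    obtain ⟨w, hw⟩ := hu β
    obtain ⟨w', hw'⟩ := hu' β
    exact ⟨w + w', hw.add hw'⟩
  zero_mem' := by
    intro β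
    refine ⟨0, ?_⟩
    intro φ hφ hc
    have key : ∀ ψ : Rd d → ℝ,
        ∫ x, (0 : Lp ℝ 2 (volume : Measure (Rd d))) x * ψ x = 0 := by
      intro ψ
      rw [← integral_zero (Rd d) ℝ]
      refine integral_congr_ae ?_
      filter_upwards [Lp.coeFn_zero ℝ 2 (volume : Measure (Rd d))] with x hx
      rw [hx, Pi.zero_apply, zero_mul]
    rw [key, key, mul_zero]
  smul_mem' := by
    intro c u hu β
    obtain ⟨w, hw⟩ := hu β
    exact ⟨c • w, hw.smul c⟩

/-- The Sobolev space `Hᵏ(ℝᵈ)`. -/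
def SobolevH (d k : ℕ) : Type := sobolevSubmodule d k

namespace SobolevH

variable {d k : ℕ}

noncomputable instance : AddCommGroup (SobolevH d k) :=
  inferInstanceAs (AddCommGroup (sobolevSubmodule d k))
noncomputable instance : Module ℝ (SobolevH d k) :=
  inferInstanceAs (Module ℝ (sobolevSubmodule d k))

/-- A representative of the class `u`. -/
noncomputable instance : CoeFun (SobolevH d k) (fun _ => Rd d → ℝ) := ⟨fun u => u.1⟩

/-- The weak derivative `D^β u ∈ L²(ℝᵈ)`. -/
noncomputable def deriv (u : SobolevH d k) (β : MultiIndex d k) :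
    Lp ℝ 2 (volume : Measure (Rd d)) :=
  (u.2 β).choose

theorem deriv_spec (u : SobolevH d k) (β : MultiIndex d k) : IsWeakDeriv β.1 u.1 (u.deriv β) :=
  (u.2 β).choose_spec

/-- The family `(D^β u)` of all weak derivatives of order at most `k`, in the Hilbert sum of
copies of `L²(ℝᵈ)`. -/
noncomputable def derivs :
    SobolevH d k →ₗ[ℝ] PiLp 2 (fun _ : MultiIndex d k => Lp ℝ 2 (volume : Measure (Rd d))) where
  toFun u := WithLp.toLp 2 fun β => u.deriv β
  map_add' u w := by
    ext1 β
    exact ((u + w).deriv_spec β).unique ((u.deriv_spec β).add (w.deriv_spec β))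
  map_smul' c u := by
    ext1 β
    exact ((c • u).deriv_spec β).unique ((u.deriv_spec β).smul c)

theorem deriv_zero (u : SobolevH d k) : u.deriv (MultiIndex.zero d k) = u.1 :=
  (u.deriv_spec _).unique (isWeakDeriv_zero_index u.1)

theorem derivs_injective : Function.Injective (derivs (d := d) (k := k)) := by
  intro u w h
  apply Subtype.ext
  rw [← u.deriv_zero, ← w.deriv_zero]
  exact congrFun (congrArg WithLp.ofLp h) (MultiIndex.zero d k)

/-- The norm `‖u‖² = ∑_{|β| ≤ k} ‖D^β u‖²_{L²}`. -/
noncomputable instance : NormedAddCommGroup (SobolevH d k) :=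
  NormedAddCommGroup.induced (SobolevH d k)
    (PiLp 2 (fun _ : MultiIndex d k => Lp ℝ 2 (volume : Measure (Rd d)))) derivs derivs_injective

noncomputable instance : NormedSpace ℝ (SobolevH d k) :=
  NormedSpace.induced ℝ (SobolevH d k)
    (PiLp 2 (fun _ : MultiIndex d k => Lp ℝ 2 (volume : Measure (Rd d)))) derivs

theorem norm_sq (u : SobolevH d k) : ‖u‖ ^ 2 = ∑ β, ‖u.deriv β‖ ^ 2 :=
  PiLp.norm_sq_eq_of_L2 _ (derivs u)

end SobolevH

/-! Write `a(g)v = α⁻¹ • (v ∘ g.pull)`, where `g.pull` is the inverse of the affine similarity `x ↦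
α ^ (p - 1) Q̃ x + b`. Inversion reverses products and so does precomposition, so `a` is a left
action.

Both norms are induced by the family of derivatives `D^β v`, `|β| ≤ k`, in a finite product of
copies of `C₀` or `L²`. Since `g.pull` is affine, `D^β (v ∘ g.pull)` is a finite sum of terms
`c_j(g) • (D^{γ_j} v ∘ g.pull)` with `|γ_j| = |β|` and `c_j` continuous on `G`
(`exists_multiDeriv_comp_pull`). Applied to test functions, the same formula holds for weak
derivatives (`exists_isWeakDeriv_actLp`). Joint continuity for every `k` thus reduces to `k = 0`.

For `k = 0` the operators are Lipschitz with a constant continuous in `g`, so it suffices that orbit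
maps are continuous on a dense set (`continuous_uncurry_of_dense`): all of `C₀`, and the classes of
compactly supported continuous functions in `L²`. Joint continuity then yields the remaining
topological claims (`exists_continuousLinearEquiv_of_continuous`). -/

namespace Burgers

/-! ### The affine change of variables attached to a group element. -/

theorem mulV_sub {d : ℕ} (A : Matrix (Fin d) (Fin d) ℝ) (x y : Rd d) :
    mulV A (x - y) = mulV A x - mulV A y := by
  simp [mulV, Matrix.mulVec_sub]

theorem continuous_mulV {d : ℕ} :
    Continuous fun q : Matrix (Fin d) (Fin d) ℝ × Rd d => mulV q.1 q.2 := by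
  unfold mulV
  exact (PiLp.continuous_toLp 2 _).comp
    (continuous_fst.matrix_mulVec ((PiLp.continuous_ofLp 2 _).comp continuous_snd))

theorem norm_mulV {d : ℕ} {A : Matrix (Fin d) (Fin d) ℝ} (hA : A.transpose * A = 1) (x : Rd d) :
    ‖mulV A x‖ = ‖x‖ := by
  have key : ∀ y : Rd d, ‖y‖ ^ 2 = y.ofLp ⬝ᵥ y.ofLp := by
    intro y
    rw [EuclideanSpace.norm_sq_eq]
    simp [dotProduct, sq]
  have h : ‖mulV A x‖ ^ 2 = ‖x‖ ^ 2 := by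
    rw [key, key]
    change A.mulVec x.ofLp ⬝ᵥ A.mulVec x.ofLp = _
    rw [Matrix.dotProduct_mulVec, ← Matrix.mulVec_transpose, Matrix.mulVec_mulVec, hA,
      Matrix.one_mulVec]
  exact (sq_eq_sq₀ (norm_nonneg _) (norm_nonneg _)).1 h

/-- The linear isometry given by an orthogonal matrix. -/
noncomputable def mulVIsometry {d : ℕ} (A : Matrix (Fin d) (Fin d) ℝ)
    (hA : A.transpose * A = 1) : Rd d ≃ₗᵢ[ℝ] Rd d :=
  LinearIsometry.toLinearIsometryEquiv
    { toFun := mulV A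
      map_add' := mulV_add A
      map_smul' := mulV_smul A
      norm_map' := norm_mulV hA } rfl

theorem aug_transpose {n : ℕ} (Q : Matrix (Fin n) (Fin n) ℝ) :
    (aug Q).transpose = aug Q.transpose := by
  ext i j
  refine Fin.cases ?_ (fun i => ?_) i <;> refine Fin.cases ?_ (fun j => ?_) j <;> simp [aug]

theorem continuous_aug {n : ℕ} :
    Continuous (aug : Matrix (Fin n) (Fin n) ℝ → Matrix (Fin (n + 1)) (Fin (n + 1)) ℝ) := by
  refine continuous_matrix fun i j => ?_
  refine Fin.cases ?_ (fun i => ?_) i <;> refine Fin.cases ?_ (fun j => ?_) j <;> simp [aug]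
  · exact continuous_const
  · exact continuous_const
  · exact continuous_const
  · exact continuous_id.matrix_elem i j

namespace G

variable {n : ℕ} {p : ℝ}

theorem aug_mul_transpose (g : G n p) : aug g.Q.1 * (aug g.Q.1).transpose = 1 := by
  rw [aug_transpose, ← aug_mul,
    (Matrix.mem_orthogonalGroup_iff _ _).1 (Matrix.mem_specialOrthogonalGroup_iff.1 g.Q.2).1,
    aug_one]

theorem transpose_mul_aug (g : G n p) : (aug g.Q.1).transpose * aug g.Q.1 = 1 :=
  mul_eq_one_comm.1 g.aug_mul_transpose

theorem continuous_prodMk : Continuous fun g : G n p => (g.α, g.Q, g.b) :=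
  continuous_induced_dom

theorem continuous_α : Continuous fun g : G n p => (g.α : ℝ) :=
  continuous_subtype_val.comp (continuous_fst.comp continuous_prodMk)

theorem continuous_Q : Continuous fun g : G n p => g.Q.1 :=
  continuous_subtype_val.comp (continuous_fst.comp (continuous_snd.comp continuous_prodMk))

theorem continuous_b : Continuous fun g : G n p => g.b :=
  continuous_snd.comp (continuous_snd.comp continuous_prodMk)

/-- The dilation factor `α ^ (1 - p)`. -/
noncomputable def scale (g : G n p) : ℝ := (g.α : ℝ) ^ (1 - p)

theorem scale_pos (g : G n p) : 0 < g.scale := Real.rpow_pos_of_pos g.α.2 _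

theorem continuous_scale : Continuous (scale : G n p → ℝ) :=
  continuous_α.rpow_const fun g => Or.inl g.α.2.ne'

/-- The linear part of the change of variables `x ↦ α ^ (1 - p) Q̃ᵀ (x - b)`. -/
noncomputable def mat (g : G n p) : Matrix (Fin (n + 1)) (Fin (n + 1)) ℝ :=
  g.scale • (aug g.Q.1).transpose

theorem continuous_mat : Continuous (mat : G n p → _) :=
  continuous_scale.smul (continuous_aug.comp continuous_Q).matrix_transpose

/-- The change of variables `x ↦ α ^ (1 - p) Q̃ᵀ (x - b)`. -/
noncomputable def pull (g : G n p) (x : Rd (n + 1)) : Rd (n + 1) :=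
  g.scale • mulV (aug g.Q.1).transpose (x - g.b)

theorem pull_eq (g : G n p) (x : Rd (n + 1)) : g.pull x = mulV g.mat (x - g.b) := by
  simp [pull, mat, mulV, Matrix.smul_mulVec]

theorem continuous_pull : Continuous fun q : G n p × Rd (n + 1) => q.1.pull q.2 := by
  simp only [pull_eq]
  exact continuous_mulV.comp ((continuous_mat.comp continuous_fst).prodMk
    (continuous_snd.sub (continuous_b.comp continuous_fst)))

theorem pull_one (x : Rd (n + 1)) : (1 : G n p).pull x = x := by
  simp [pull, scale, one_def, aug_one, mulV_one]

/-- The order is reversed because `pull` inverts the affine map of `g`. The factors `α ^ (1 - p)`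
and `α ^ (p - 1)` cancel on the translation part, as do `Q̃ᵀ` and `Q̃`. -/
theorem pull_mul (g h : G n p) (x : Rd (n + 1)) : (g * h).pull x = h.pull (g.pull x) := by
  have e : (g.α : ℝ) ^ (1 - p) * (g.α : ℝ) ^ (p - 1) = 1 := by
    rw [← Real.rpow_add g.α.2]; simp
  have e1 : g.scale • mulV (aug g.Q.1).transpose
      ((g.α : ℝ) ^ (p - 1) • mulV (aug g.Q.1) h.b) = h.b := by
    rw [mulV_smul, mulV_mulV, transpose_mul_aug, mulV_one, smul_smul, scale, e, one_smul]
  have e2 : g.pull x - h.b = g.scale • mulV (aug g.Q.1).transpose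
      (x - (g.b + (g.α : ℝ) ^ (p - 1) • mulV (aug g.Q.1) h.b)) := by
    rw [← sub_sub, mulV_sub, smul_sub, e1, pull]
  have e3 : (g * h).scale = h.scale * g.scale := by
    simp only [scale, mul_def, Positive.val_mul]
    rw [Real.mul_rpow g.α.2.le h.α.2.le, mul_comm]
  conv_rhs => rw [pull, e2, mulV_smul, mulV_mulV, smul_smul, ← Matrix.transpose_mul, ← aug_mul]
  rw [pull, e3]
  rfl

theorem pull_pull_inv (g : G n p) (x : Rd (n + 1)) : g.pull (g⁻¹.pull x) = x := by
  rw [← pull_mul, inv_mul_cancel, pull_one]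

theorem pull_inv_pull (g : G n p) (x : Rd (n + 1)) : g⁻¹.pull (g.pull x) = x := by
  rw [← pull_mul, mul_inv_cancel, pull_one]

theorem continuous_pull_right (g : G n p) : Continuous g.pull :=
  continuous_pull.comp (Continuous.prodMk_right g)

/-- The change of variables as a homeomorphism. -/
noncomputable def homeo (g : G n p) : Rd (n + 1) ≃ₜ Rd (n + 1) where
  toFun := g.pull
  invFun := g⁻¹.pull
  left_inv := g.pull_inv_pull
  right_inv := g.pull_pull_inv
  continuous_toFun := g.continuous_pull_right
  continuous_invFun := g⁻¹.continuous_pull_right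

theorem coe_homeo (g : G n p) : ⇑g.homeo = g.pull := rfl

theorem norm_pull (g : G n p) (x : Rd (n + 1)) : ‖g.pull x‖ = g.scale * ‖x - g.b‖ := by
  rw [pull, norm_smul, norm_mulV (by simpa using g.aug_mul_transpose), Real.norm_eq_abs,
    abs_of_pos g.scale_pos]

/-- Escape to infinity is uniform for `g` near `g₀`, because `‖g.pull x‖ ≥ g.scale * (‖x‖ - ‖g.b‖)`
with `scale` and `b` continuous. This supplies one compact set serving all nearby `g`, in both
function spaces. -/
theorem tendsto_pull_cocompact (g₀ : G n p) :
    Tendsto (fun q : G n p × Rd (n + 1) => q.1.pull q.2) (𝓝 g₀ ×ˢ cocompact _)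
      (cocompact _) := by
  rw [← Metric.cobounded_eq_cocompact, ← comap_norm_atTop (E := Rd (n + 1)), tendsto_comap_iff]
  have hs : Tendsto (fun q : G n p × Rd (n + 1) => q.1.scale)
      (𝓝 g₀ ×ˢ comap norm atTop) (𝓝 g₀.scale) :=
    (continuous_scale.tendsto g₀).comp tendsto_fst
  have hb : Tendsto (fun q : G n p × Rd (n + 1) => -‖q.1.b‖)
      (𝓝 g₀ ×ˢ comap norm atTop) (𝓝 (-‖g₀.b‖)) :=
    (continuous_b.norm.neg.tendsto g₀).comp tendsto_fst
  have hx : Tendsto (fun q : G n p × Rd (n + 1) => ‖q.2‖)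
      (𝓝 g₀ ×ˢ comap norm atTop) atTop := tendsto_comap.comp tendsto_snd
  refine tendsto_atTop_mono (fun q => ?_) (hs.pos_mul_atTop g₀.scale_pos (hb.add_atTop hx))
  rw [Function.comp_apply, norm_pull]
  refine mul_le_mul_of_nonneg_left ?_ q.1.scale_pos.le
  linarith [norm_sub_norm_le q.2 q.1.b]

/-- Translations and orthogonal maps preserve volume; only the dilation contributes, with exponent
the dimension `n + 1`. -/
theorem map_pull_volume (g : G n p) :
    Measure.map g.pull volume = ENNReal.ofReal ((g.scale ^ (n + 1))⁻¹) • volume := by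
  have h1 : MeasurePreserving (fun x : Rd (n + 1) => x - g.b) :=
    measurePreserving_sub_right volume g.b
  have h2 := (mulVIsometry (aug g.Q.1).transpose
    (by simpa using g.aug_mul_transpose)).measurePreserving
  have h3 := h2.comp h1
  have e : g.pull = (fun x => g.scale • x) ∘ (mulVIsometry (aug g.Q.1).transpose
    (by simpa using g.aug_mul_transpose) ∘ fun x => x - g.b) := rfl
  rw [e, ← Measure.map_map (measurable_const_smul _) h3.measurable, h3.map_eq,
    Measure.map_addHaar_smul _ g.scale_pos.ne', finrank_euclideanSpace_fin,
    abs_of_pos (inv_pos.2 (pow_pos g.scale_pos _))]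

theorem quasiMeasurePreserving_pull (g : G n p) :
    Measure.QuasiMeasurePreserving g.pull volume volume :=
  ⟨g.continuous_pull_right.measurable, by
    rw [map_pull_volume]; exact Measure.smul_absolutelyContinuous⟩

theorem integral_comp_pull (g : G n p) (f : Rd (n + 1) → ℝ) :
    ∫ x, f (g.pull x) = (g.scale ^ (n + 1))⁻¹ * ∫ x, f x := by
  have h := g.homeo.measurableEmbedding.integral_map (μ := volume) f
  rw [coe_homeo, map_pull_volume, integral_smul_measure,
    ENNReal.toReal_ofReal (inv_pos.2 (pow_pos g.scale_pos _)).le] at h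
  exact h.symm

end G

/-! ### Algebraic identities of the action on plain functions. -/

theorem act_apply {n : ℕ} {p : ℝ} (g : G n p) (v : Rd (n + 1) → ℝ) (x : Rd (n + 1)) :
    act g v x = (g.α : ℝ)⁻¹ * v (g.pull x) := rfl

theorem act_one {n : ℕ} {p : ℝ} (v : Rd (n + 1) → ℝ) : act (1 : G n p) v = v := by
  funext x
  rw [act_apply, G.pull_one]
  simp [G.one_def]

theorem act_mul {n : ℕ} {p : ℝ} (g h : G n p) (v : Rd (n + 1) → ℝ) :
    act (g * h) v = act g (act h v) := by
  funext x
  rw [act_apply, act_apply, act_apply, G.pull_mul, ← mul_assoc, G.mul_def, Positive.val_mul,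
    mul_inv]

theorem act_add {n : ℕ} {p : ℝ} (g : G n p) (u v : Rd (n + 1) → ℝ) :
    act g (u + v) = act g u + act g v := by
  funext x
  simp [act_apply, mul_add]

theorem act_smul {n : ℕ} {p : ℝ} (g : G n p) (c : ℝ) (v : Rd (n + 1) → ℝ) :
    act g (c • v) = c • act g v := by
  funext x
  simp only [act_apply, Pi.smul_apply, smul_eq_mul]
  ring

end Burgers

/-! ### Commuting partial derivatives and the chain rule under affine maps. -/

section Calculus

variable {d : ℕ}

theorem pderiv_comm (i j : Fin d) {u : Rd d → ℝ} (hu : ContDiff ℝ 2 u) :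
    pderiv i (pderiv j u) = pderiv j (pderiv i u) := by
  have h1 : Differentiable ℝ (fderiv ℝ u) :=
    (hu.fderiv_right (m := 1) (by norm_num)).differentiable (by norm_num)
  have key : ∀ (a b : Fin d) (x : Rd d), pderiv a (pderiv b u) x =
      fderiv ℝ (fderiv ℝ u) x (EuclideanSpace.single a 1) (EuclideanSpace.single b 1) := by
    intro a b x
    unfold pderiv
    rw [fderiv_clm_apply (h1 x) (differentiableAt_const _)]
    simp
  funext x
  rw [key, key]
  exact hu.contDiffAt.isSymmSndFDerivAt (by simp) _ _

theorem pderiv_iterate_comm (i j : Fin d) (r : ℕ) : ∀ {u : Rd d → ℝ},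
    ContDiff ℝ ((r + 1 : ℕ) : WithTop ℕ∞) u →
      pderiv j ((pderiv i)^[r] u) = (pderiv i)^[r] (pderiv j u) := by
  induction r with
  | zero => intro u _; rfl
  | succ r ih =>
    intro u hu
    rw [Function.iterate_succ_apply, Function.iterate_succ_apply, ih (pderiv_contDiff i hu),
      pderiv_comm j i (hu.of_le (by norm_cast; omega))]

theorem listDeriv_congr {β γ : Fin d → ℕ} {l : List (Fin d)} (h : ∀ i ∈ l, β i = γ i)
    (u : Rd d → ℝ) : listDeriv β l u = listDeriv γ l u := by
  induction l with
  | nil => rfl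
  | cons i l ih =>
    change (pderiv i)^[β i] (listDeriv β l u) = (pderiv i)^[γ i] (listDeriv γ l u)
    rw [ih fun j hj => h j (List.mem_cons_of_mem _ hj), h i List.mem_cons_self]

/-- `multiDeriv` applies the partials in a fixed order, while the chain rule produces an extra `∂ⱼ`
on the outside. Symmetry of second derivatives moves it to its slot; `Nodup` ensures that there is
only one such slot. -/
theorem pderiv_listDeriv (β : Fin d → ℕ) (j : Fin d) {l : List (Fin d)} (hl : l.Nodup)
    (hj : j ∈ l) {u : Rd d → ℝ}
    (hu : ContDiff ℝ (((l.map β).sum + 1 : ℕ) : WithTop ℕ∞) u) :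
    pderiv j (listDeriv β l u) = listDeriv (β + Pi.single j 1) l u := by
  induction l with
  | nil => simp at hj
  | cons i l ih =>
    change pderiv j ((pderiv i)^[β i] (listDeriv β l u)) =
      (pderiv i)^[(β + Pi.single j 1 : Fin d → ℕ) i] (listDeriv (β + Pi.single j 1) l u)
    rw [List.nodup_cons] at hl
    by_cases hij : j = i
    · subst hij
      rw [← Function.iterate_succ_apply' (pderiv j)]
      have e : listDeriv (β + Pi.single j 1) l u = listDeriv β l u := by
        refine listDeriv_congr (fun i hi => ?_) u
        have : i ≠ j := fun h => hl.1 (h ▸ hi)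
        simp [this]
      rw [e]
      simp
    · have hjl : j ∈ l := (List.mem_cons.1 hj).resolve_left hij
      rw [pderiv_iterate_comm i j (β i), ih hl.2 hjl]
      · have : i ≠ j := fun h => hij h.symm
        simp [this]
      · refine hu.of_le ?_
        norm_cast
        simp
      · refine listDeriv_contDiff β l (hu.of_le ?_)
        norm_cast
        simp only [List.map_cons, List.sum_cons]
        omega

theorem pderiv_multiDeriv (β : Fin d → ℕ) (j : Fin d) {u : Rd d → ℝ}
    (hu : ContDiff ℝ ((∑ i, β i + 1 : ℕ) : WithTop ℕ∞) u) :
    pderiv j (multiDeriv β u) = multiDeriv (β + Pi.single j 1) u :=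
  pderiv_listDeriv β j (List.nodup_finRange d) (List.mem_finRange j)
    (by rwa [sum_map_finRange])

/-- `x ↦ A (x - b)`. -/
noncomputable def affineMap (A : Matrix (Fin d) (Fin d) ℝ) (b x : Rd d) : Rd d := Burgers.mulV A (x - b)

theorem hasFDerivAt_affineMap (A : Matrix (Fin d) (Fin d) ℝ) (b x : Rd d) :
    HasFDerivAt (affineMap A b) (Matrix.toEuclideanCLM (𝕜 := ℝ) A) x := by
  have h := (Matrix.toEuclideanCLM (𝕜 := ℝ) A).hasFDerivAt (x := x - b)
  exact h.comp x ((hasFDerivAt_id x).sub_const b)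

theorem contDiff_affineMap (A : Matrix (Fin d) (Fin d) ℝ) (b : Rd d) {m : WithTop ℕ∞} :
    ContDiff ℝ m (affineMap A b) :=
  (Matrix.toEuclideanCLM (𝕜 := ℝ) A).contDiff.comp (contDiff_id.sub contDiff_const)

theorem pderiv_comp_affineMap (A : Matrix (Fin d) (Fin d) ℝ) (b : Rd d) (i : Fin d)
    {u : Rd d → ℝ} (hu : Differentiable ℝ u) (x : Rd d) :
    pderiv i (fun y => u (affineMap A b y)) x = ∑ j, A j i * pderiv j u (affineMap A b x) := by
  have h := ((hu _).hasFDerivAt.comp x (hasFDerivAt_affineMap A b x)).fderiv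
  -- The image of a basis vector is a column of `A`; this is where the entries `A j i` come from.
  have e : Matrix.toEuclideanCLM (𝕜 := ℝ) A (EuclideanSpace.single i 1) =
      ∑ j, A j i • EuclideanSpace.single j (1 : ℝ) := by
    ext l
    simp [Matrix.ofLp_toEuclideanCLM, Pi.single_apply]
  change fderiv ℝ (u ∘ affineMap A b) x _ = _
  rw [h, ContinuousLinearMap.comp_apply, e, map_sum]
  simp [pderiv]

/-- `L` is an operator of order `r` for which there is a chain rule under affine changes of
variables, with coefficients depending continuously on the linear part. -/
def HasAffineChainRule (r : ℕ) (L : (Rd d → ℝ) → Rd d → ℝ) : Prop :=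
  ∃ (ι : Type) (_ : Fintype ι) (γ : ι → Fin d → ℕ) (c : ι → Matrix (Fin d) (Fin d) ℝ → ℝ),
    (∀ j, ∑ i, γ j i = r) ∧ (∀ j, Continuous (c j)) ∧
    ∀ u : Rd d → ℝ, ContDiff ℝ (r : WithTop ℕ∞) u →
      ∀ A b, L (fun x => u (affineMap A b x)) =
        fun x => ∑ j, c j A * multiDeriv (γ j) u (affineMap A b x)

theorem hasAffineChainRule_id : HasAffineChainRule 0 (fun u : Rd d → ℝ => u) := by
  refine ⟨Unit, inferInstance, fun _ => 0, fun _ _ => 1, by simp, fun _ => continuous_const, ?_⟩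
  intro u _ A b
  simp [multiDeriv_zero]

/-- The coefficients do not depend on `x`, so differentiating creates no product-rule terms: each
summand splits into `d` new ones, indexed by the direction `j`, with extra factor `A j i` and one
more derivative on `u`. -/
theorem HasAffineChainRule.comp_pderiv {r : ℕ} {L : (Rd d → ℝ) → Rd d → ℝ}
    (h : HasAffineChainRule r L) (i : Fin d) :
    HasAffineChainRule (r + 1) (fun u => pderiv i (L u)) := by
  obtain ⟨ι, _, γ, c, hγ, hc, h⟩ := h
  refine ⟨ι × Fin d, inferInstance, fun q => γ q.1 + Pi.single q.2 1,
    fun q A => c q.1 A * A q.2 i, ?_, ?_, ?_⟩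
  · rintro ⟨q, j⟩
    simp [Finset.sum_add_distrib, hγ]
  · rintro ⟨q, j⟩
    exact (hc q).mul (continuous_id.matrix_elem j i)
  · intro u hu A b
    have hd : ∀ q, Differentiable ℝ (multiDeriv (γ q) u) := fun q =>
      (multiDeriv_contDiff (m := 1) (γ q) (by rw [hγ, add_comm]; exact hu)).differentiable
        (by norm_num)
    have hd' : ∀ q x, DifferentiableAt ℝ
        (fun x => c q A * multiDeriv (γ q) u (affineMap A b x)) x := fun q x =>
      (((hd q) _).comp x (hasFDerivAt_affineMap A b x).differentiableAt).const_mul _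
    beta_reduce
    rw [h u (hu.of_le (by norm_cast; omega)) A b]
    funext x
    unfold pderiv
    rw [fderiv_fun_sum fun q _ => hd' q x, _root_.sum_apply, Fintype.sum_prod_type]
    refine Finset.sum_congr rfl fun q _ => ?_
    have h1 := pderiv_comp_affineMap A b i (hd q) x
    have h2 : fderiv ℝ (fun x => c q A * multiDeriv (γ q) u (affineMap A b x)) x =
        c q A • fderiv ℝ (fun x => multiDeriv (γ q) u (affineMap A b x)) x :=
      fderiv_const_mul (((hd q) _).comp x (hasFDerivAt_affineMap A b x).differentiableAt) _
    rw [h2]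
    simp only [_root_.smul_apply, smul_eq_mul]
    unfold pderiv at h1
    rw [h1, Finset.mul_sum]
    refine Finset.sum_congr rfl fun j _ => ?_
    rw [← pderiv_multiDeriv (γ q) j (by rw [hγ]; exact hu), mul_assoc]
    rfl

theorem HasAffineChainRule.iterate_pderiv {r : ℕ} {L : (Rd d → ℝ) → Rd d → ℝ}
    (h : HasAffineChainRule r L) (i : Fin d) (s : ℕ) :
    HasAffineChainRule (r + s) (fun u => (pderiv i)^[s] (L u)) := by
  induction s with
  | zero => exact h
  | succ s ih =>
    have := ih.comp_pderiv i
    simpa only [Function.iterate_succ_apply', add_assoc] using this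

theorem hasAffineChainRule_multiDeriv (β : Fin d → ℕ) :
    HasAffineChainRule (∑ i, β i) (multiDeriv β) := by
  rw [← sum_map_finRange]
  unfold multiDeriv
  induction List.finRange d with
  | nil => exact hasAffineChainRule_id
  | cons i l ih =>
    rw [List.map_cons, List.sum_cons, add_comm]
    exact ih.iterate_pderiv i (β i)

end Calculus

/-! ### Order zero: joint continuity on `C₀` and `L²`. -/

/-- Approximate `y₀` by some `z ∈ D` and pass from `A g y` to `A g z` to `A g₀ z` to `A g₀ y₀`; the
locally bounded Lipschitz constant controls the outer steps, continuity of the orbit of `z` the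
middle one. -/
theorem continuous_uncurry_of_dense {P Y : Type*} [TopologicalSpace P] [NormedAddCommGroup Y]
    {A : P → Y → Y} {C : P → ℝ} (hC : Continuous C)
    (hA : ∀ g y z, ‖A g y - A g z‖ ≤ C g * ‖y - z‖) {D : Set Y} (hD : Dense D)
    (h : ∀ y ∈ D, Continuous fun g => A g y) : Continuous fun q : P × Y => A q.1 q.2 := by
  rw [continuous_iff_continuousAt]
  rintro ⟨g₀, y₀⟩
  rw [ContinuousAt, Metric.tendsto_nhds]
  intro ε hε
  set M := |C g₀| + 1 with hM
  have hMpos : 0 < M := by positivity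
  -- With radius `ε / (6 * M)` the three steps cost at most `ε / 3`, `ε / 2` and `ε / 6`, the last
  -- two strictly.
  have hδ : 0 < ε / (6 * M) := by positivity
  obtain ⟨z, hzD, hz⟩ := hD.exists_dist_lt y₀ hδ
  have e1 : ∀ᶠ g in 𝓝 g₀, C g < M :=
    hC.continuousAt.eventually_lt continuousAt_const (by
      rw [hM]; linarith [le_abs_self (C g₀)])
  have e2 : ∀ᶠ g in 𝓝 g₀, dist (A g z) (A g₀ z) < ε / 2 :=
    Metric.tendsto_nhds.1 ((h z hzD).tendsto g₀) _ (half_pos hε)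
  have e3 : ∀ᶠ y in 𝓝 y₀, dist y y₀ < ε / (6 * M) := Metric.ball_mem_nhds _ hδ
  rw [nhds_prod_eq]
  filter_upwards [(e1.and e2).prod_mk e3] with q hq
  obtain ⟨⟨h1, h2⟩, h3⟩ := hq
  have b : ∀ g y w, C g < M → dist (A g y) (A g w) ≤ M * dist y w := fun g y w hg => by
    rw [dist_eq_norm, dist_eq_norm]
    exact (hA g y w).trans (mul_le_mul_of_nonneg_right hg.le (norm_nonneg _))
  have b1 := b q.1 q.2 z h1
  have b2 := b g₀ z y₀ e1.self_of_nhds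
  have t : dist q.2 z ≤ ε / (6 * M) + ε / (6 * M) :=
    (dist_triangle _ y₀ _).trans (add_le_add h3.le hz.le)
  have eM : M * (ε / (6 * M)) = ε / 6 := by field_simp
  have c1 : M * dist q.2 z ≤ ε / 6 + ε / 6 := by
    rw [← eM, ← mul_add]
    exact mul_le_mul_of_nonneg_left t hMpos.le
  have c2 : M * dist z y₀ < ε / 6 := by
    rw [← eM, dist_comm]
    exact mul_lt_mul_of_pos_left hz hMpos
  calc dist (A q.1 q.2) (A g₀ y₀)
      ≤ dist (A q.1 q.2) (A q.1 z) + dist (A q.1 z) (A g₀ z) + dist (A g₀ z) (A g₀ y₀) :=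
        dist_triangle4 _ _ _ _
    _ < ε := by linarith

namespace Burgers

variable {n : ℕ} {p : ℝ}

theorem continuous_inv_α : Continuous fun g : G n p => (g.α : ℝ)⁻¹ :=
  G.continuous_α.inv₀ fun g => g.α.2.ne'

theorem act_continuous {f : Rd (n + 1) → ℝ} (hf : Continuous f) :
    Continuous fun q : G n p × Rd (n + 1) => act q.1 f q.2 := by
  simp only [act_apply]
  exact (continuous_inv_α.comp continuous_fst).mul (hf.comp G.continuous_pull)

theorem tendsto_act_cocompact {f : Rd (n + 1) → ℝ} (hf : Tendsto f (cocompact _) (𝓝 0))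
    (g₀ : G n p) :
    Tendsto (fun q : G n p × Rd (n + 1) => act q.1 f q.2) (𝓝 g₀ ×ˢ cocompact _) (𝓝 0) := by
  have h := ((continuous_inv_α.tendsto g₀).comp tendsto_fst).mul
    (hf.comp (G.tendsto_pull_cocompact g₀))
  rw [mul_zero] at h
  exact h

theorem tendsto_act_cocompact_right {f : Rd (n + 1) → ℝ} (hf : Tendsto f (cocompact _) (𝓝 0))
    (g : G n p) : Tendsto (act g f) (cocompact _) (𝓝 0) :=
  (tendsto_act_cocompact hf g).comp
    (((tendsto_pure_nhds id g).comp tendsto_const_pure).prodMk tendsto_id)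

/-- The action on the space of continuous functions vanishing at infinity. -/
noncomputable def actZero (g : G n p) (f : ZeroAtInftyContinuousMap (Rd (n + 1)) ℝ) :
    ZeroAtInftyContinuousMap (Rd (n + 1)) ℝ where
  toFun := act g f
  continuous_toFun := (act_continuous f.continuous).comp (Continuous.prodMk_right g)
  zero_at_infty' := tendsto_act_cocompact_right f.zero_at_infty' g

/-- The Lipschitz constant in the sup norm is `α⁻¹`, and every orbit map is continuous, so the dense
set is the whole space. -/
theorem continuous_actZero : Continuous fun q : G n p × ZeroAtInftyContinuousMap (Rd (n + 1)) ℝ =>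
    actZero q.1 q.2 := by
  refine continuous_uncurry_of_dense continuous_inv_α (fun g y z => ?_) dense_univ fun f _ => ?_
  · rw [← ZeroAtInftyContinuousMap.norm_toBCF_eq_norm, BoundedContinuousFunction.norm_le
      (mul_nonneg (inv_nonneg.2 g.α.2.le) (norm_nonneg _))]
    intro x
    change ‖(g.α : ℝ)⁻¹ * y (g.pull x) - (g.α : ℝ)⁻¹ * z (g.pull x)‖ ≤ _
    rw [← mul_sub, norm_mul, Real.norm_of_nonneg (inv_nonneg.2 g.α.2.le),
      ← ZeroAtInftyContinuousMap.norm_toBCF_eq_norm]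
    exact mul_le_mul_of_nonneg_left
      ((y - z).toBCF.norm_coe_le_norm (g.pull x)) (inv_nonneg.2 g.α.2.le)
  · rw [continuous_iff_continuousAt]
    intro g₀
    rw [ContinuousAt, ZeroAtInftyContinuousMap.tendsto_iff_tendstoUniformly,
      Metric.tendstoUniformly_iff]
    intro ε hε
    have h0 : Tendsto (fun q : G n p × Rd (n + 1) => dist (act g₀ f q.2) (act q.1 f q.2))
        (𝓝 g₀ ×ˢ cocompact _) (𝓝 0) := by
      have := ((tendsto_act_cocompact_right f.zero_at_infty' g₀).comp tendsto_snd).dist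
        (tendsto_act_cocompact f.zero_at_infty' g₀)
      rw [dist_self] at this
      exact this
    -- Outside `K` the two functions are within `ε`, uniformly for `g` near `g₀`; on `K`,
    -- compactness makes pointwise continuity uniform.
    obtain ⟨U, hU, V, hV, hUV⟩ := eventually_prod_iff.1 (h0.eventually (gt_mem_nhds hε))
    obtain ⟨K, hK, hKV⟩ := mem_cocompact.1 hV
    have hc : Continuous fun q : G n p × Rd (n + 1) => dist (act g₀ f q.2) (act q.1 f q.2) :=
      ((act_continuous f.continuous).comp ((Continuous.prodMk_right g₀).comp continuous_snd)).dist
        (act_continuous f.continuous)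
    have hK' : ∀ᶠ g in 𝓝 g₀, ∀ x ∈ K, dist (act g₀ f x) (act g f x) < ε := by
      refine hK.eventually_forall_of_forall_eventually fun x _ => ?_
      exact hc.continuousAt.eventually_lt continuousAt_const (by simpa using hε)
    filter_upwards [hU, hK'] with g hg hgK x
    by_cases hx : x ∈ K
    · exact hgK x hx
    · exact hUV hg (hKV hx)

theorem memLp_act (g : G n p) {f : Rd (n + 1) → ℝ} (hf : MemLp f 2 volume) :
    MemLp (act g f) 2 volume := by
  have h : MemLp f 2 (Measure.map g.pull volume) := by
    rw [G.map_pull_volume]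
    exact hf.smul_measure ENNReal.ofReal_ne_top
  exact (h.comp_of_map g.continuous_pull_right.aemeasurable).const_mul _

theorem act_congr_ae (g : G n p) {f f' : Rd (n + 1) → ℝ} (h : f =ᵐ[volume] f') :
    act g f =ᵐ[volume] act g f' := by
  filter_upwards [g.quasiMeasurePreserving_pull.ae_eq_comp h] with x hx
  rw [act_apply, act_apply]
  exact congrArg _ hx

/-- The action on `L²`. -/
noncomputable def actLp (g : G n p) (f : Lp ℝ 2 (volume : Measure (Rd (n + 1)))) :
    Lp ℝ 2 (volume : Measure (Rd (n + 1))) :=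
  (memLp_act g (Lp.memLp f)).toLp

theorem coeFn_actLp (g : G n p) (f : Lp ℝ 2 (volume : Measure (Rd (n + 1)))) :
    actLp g f =ᵐ[volume] act g f := MemLp.coeFn_toLp _

theorem actLp_one (f : Lp ℝ 2 (volume : Measure (Rd (n + 1)))) : actLp (1 : G n p) f = f :=
  Lp.ext ((coeFn_actLp _ _).trans (by rw [act_one]))

theorem actLp_mul (g h : G n p) (f : Lp ℝ 2 (volume : Measure (Rd (n + 1)))) :
    actLp (g * h) f = actLp g (actLp h f) := by
  refine Lp.ext ((coeFn_actLp _ _).trans ?_)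
  rw [act_mul]
  exact ((coeFn_actLp _ _).trans (act_congr_ae g (coeFn_actLp _ _))).symm

theorem actLp_add (g : G n p) (f f' : Lp ℝ 2 (volume : Measure (Rd (n + 1)))) :
    actLp g (f + f') = actLp g f + actLp g f' := by
  refine Lp.ext ((coeFn_actLp _ _).trans ((act_congr_ae g (Lp.coeFn_add f f')).trans ?_))
  rw [act_add]
  exact ((coeFn_actLp g f).add (coeFn_actLp g f')).symm.trans (Lp.coeFn_add _ _).symm

theorem actLp_smul (g : G n p) (c : ℝ) (f : Lp ℝ 2 (volume : Measure (Rd (n + 1)))) :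
    actLp g (c • f) = c • actLp g f := by
  refine Lp.ext ((coeFn_actLp _ _).trans ((act_congr_ae g (Lp.coeFn_smul c f)).trans ?_))
  rw [act_smul]
  exact ((coeFn_actLp g f).const_smul c).symm.trans (Lp.coeFn_smul _ _).symm

theorem actLp_sub (g : G n p) (f f' : Lp ℝ 2 (volume : Measure (Rd (n + 1)))) :
    actLp g (f - f') = actLp g f - actLp g f' := by
  rw [sub_eq_add_neg, actLp_add, ← neg_one_smul ℝ f', actLp_smul, neg_one_smul, sub_eq_add_neg]

theorem norm_sq_Lp {d : ℕ} (f : Lp ℝ 2 (volume : Measure (Rd d))) :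
    ‖f‖ ^ 2 = ∫ x, f x ^ 2 := by
  rw [← real_inner_self_eq_norm_sq, L2.inner_def]
  simp [sq]

/-- The square root is that of the Jacobian factor in the change of variables. -/
theorem norm_actLp (g : G n p) (f : Lp ℝ 2 (volume : Measure (Rd (n + 1)))) :
    ‖actLp g f‖ = (g.α : ℝ)⁻¹ * √((g.scale ^ (n + 1))⁻¹) * ‖f‖ := by
  have hα : 0 ≤ (g.α : ℝ)⁻¹ := inv_nonneg.2 g.α.2.le
  refine (sq_eq_sq₀ (norm_nonneg _) (by positivity)).1 ?_
  rw [mul_pow, mul_pow, Real.sq_sqrt (inv_nonneg.2 (pow_nonneg g.scale_pos.le _)), norm_sq_Lp,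
    norm_sq_Lp, mul_assoc, ← g.integral_comp_pull (fun x => f x ^ 2), ← integral_const_mul]
  refine integral_congr_ae ?_
  filter_upwards [coeFn_actLp g f] with x hx
  rw [hx, act_apply, mul_pow]

/-- For `g` near `g₀` the transformed functions all vanish off one compact set, so the squared `L²`
distance is a parametric integral of a continuous integrand over that set. -/
theorem continuous_actLp_of_hasCompactSupport {f : Rd (n + 1) → ℝ} (hf : Continuous f)
    (hc : HasCompactSupport f) (y : Lp ℝ 2 (volume : Measure (Rd (n + 1))))
    (hy : y =ᵐ[volume] f) : Continuous fun g : G n p => actLp g y := by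
  rw [continuous_iff_continuousAt]
  intro g₀
  have hcF : Continuous fun q : G n p × Rd (n + 1) => (act q.1 f q.2 - act g₀ f q.2) ^ 2 :=
    ((act_continuous hf).sub
      ((act_continuous hf).comp ((Continuous.prodMk_right g₀).comp continuous_snd))).pow 2
  have hK : ∀ᶠ q in 𝓝 g₀ ×ˢ cocompact (Rd (n + 1)), act q.1 f q.2 = 0 := by
    filter_upwards [(G.tendsto_pull_cocompact g₀).eventually hc.isCompact.compl_mem_cocompact]
      with q hq
    rw [act_apply, image_eq_zero_of_notMem_tsupport hq, mul_zero]
  obtain ⟨U, hU, V, hV, hUV⟩ := eventually_prod_iff.1 hK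
  obtain ⟨K, hK, hKV⟩ := mem_cocompact.1 hV
  have hJ : ContinuousOn (fun g : G n p => ∫ x, (act g f x - act g₀ f x) ^ 2) {g | U g} := by
    refine continuousOn_integral_of_compact_support hK hcF.continuousOn fun g x hg hx => ?_
    rw [hUV hg (hKV hx), hUV hU.self_of_nhds (hKV hx)]
    simp
  have hJ' := (hJ.continuousAt hU).tendsto
  have e : ∀ g : G n p, ‖actLp g y - actLp g₀ y‖ ^ 2 = ∫ x, (act g f x - act g₀ f x) ^ 2 := by
    intro g
    rw [norm_sq_Lp]
    refine integral_congr_ae ?_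
    filter_upwards [Lp.coeFn_sub (actLp g y) (actLp g₀ y), coeFn_actLp g y, coeFn_actLp g₀ y,
      act_congr_ae g hy, act_congr_ae g₀ hy] with x h1 h2 h3 h4 h5
    rw [h1, Pi.sub_apply, h2, h3, h4, h5]
  simp only [← e] at hJ'
  have hs := hJ'.sqrt
  simp only [sub_self, Real.sqrt_sq (norm_nonneg _), norm_zero] at hs
  rw [Real.sqrt_sq le_rfl] at hs
  exact tendsto_iff_norm_sub_tendsto_zero.2 hs

theorem continuous_actLp : Continuous
    fun q : G n p × Lp ℝ 2 (volume : Measure (Rd (n + 1))) => actLp q.1 q.2 := by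
  refine continuous_uncurry_of_dense
    (C := fun g : G n p => (g.α : ℝ)⁻¹ * √((g.scale ^ (n + 1))⁻¹))
    (D := {y | ∃ f : Rd (n + 1) → ℝ, Continuous f ∧ HasCompactSupport f ∧ y =ᵐ[volume] f})
    ?_ (fun g y z => ?_) ?_ ?_
  · exact continuous_inv_α.mul
      ((G.continuous_scale.pow _).inv₀ fun g => (pow_pos g.scale_pos _).ne').sqrt
  · rw [← actLp_sub, norm_actLp]
  · rw [Metric.dense_iff]
    intro y ε hε
    -- The approximation lemma gives a non-strict bound; `ε / 2` leaves room for the open ball.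
    obtain ⟨f, hfc, hfe, hf, hfm⟩ := (Lp.memLp y).exists_hasCompactSupport_eLpNorm_sub_le
      (by norm_num) (ε := ENNReal.ofReal (ε / 2)) (by simpa using hε)
    refine ⟨hfm.toLp, ?_, f, hf, hfc, hfm.coeFn_toLp⟩
    rw [Metric.mem_ball, dist_comm, dist_eq_norm]
    refine lt_of_le_of_lt ?_ (half_lt_self hε)
    rw [Lp.norm_def]
    refine ENNReal.toReal_le_of_le_ofReal (half_pos hε).le ?_
    refine le_trans (le_of_eq (eLpNorm_congr_ae ?_)) hfe
    filter_upwards [Lp.coeFn_sub y hfm.toLp, hfm.coeFn_toLp] with x h1 h2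
    rw [h1, Pi.sub_apply, h2, Pi.sub_apply]
  · rintro y ⟨f, hf, hc, hy⟩
    exact continuous_actLp_of_hasCompactSupport hf hc y hy

end Burgers

/-! ### From a jointly continuous action to topological isomorphisms. -/

/-- Freezing `g` in the joint continuity gives boundedness, also of the inverse `a g⁻¹`; freezing
`v` gives the limit at `1`. -/
theorem exists_continuousLinearEquiv_of_continuous {Γ X : Type*} [Group Γ] [TopologicalSpace Γ]
    [NormedAddCommGroup X] [NormedSpace ℝ X] (a : Γ → X →ₗ[ℝ] X) (h1 : ∀ v, a 1 v = v)
    (hmul : ∀ g h v, a (g * h) v = a g (a h v)) (hc : Continuous fun q : Γ × X => a q.1 q.2) :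
    ∃ A : Γ → (X ≃L[ℝ] X), (∀ g v, A g v = a g v) ∧ A 1 = ContinuousLinearEquiv.refl ℝ X ∧
      (∀ g h v, A (g * h) v = A g (A h v)) ∧
      (∀ v, Tendsto (fun g => A g v) (𝓝 1) (𝓝 v)) ∧ Continuous fun q : Γ × X => A q.1 q.2 := by
  have hr : ∀ g, Continuous (a g) := fun g => hc.comp (Continuous.prodMk_right g)
  refine ⟨fun g => ⟨LinearEquiv.ofLinearMap (a g) (a g⁻¹) ?_ ?_, hr g, hr g⁻¹⟩,
    fun _ _ => rfl, ?_, hmul, fun v => ?_, hc⟩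
  · ext v
    simp [← hmul, h1]
  · ext v
    simp [← hmul, h1]
  · ext v
    exact h1 v
  · have h := (hc.comp (Continuous.prodMk_left v)).tendsto 1
    simp only [Function.comp_apply, h1] at h
    exact h

theorem zeroAtInfty_sum_apply {E ι : Type*} [TopologicalSpace E] (s : Finset ι)
    (f : ι → ZeroAtInftyContinuousMap E ℝ) (x : E) : (∑ j ∈ s, f j) x = ∑ j ∈ s, f j x :=
  map_sum (⟨⟨fun h : ZeroAtInftyContinuousMap E ℝ => h x, rfl⟩, fun _ _ => rfl⟩ :
    ZeroAtInftyContinuousMap E ℝ →+ ℝ) f s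

/-! ### Lifting the action to `C₀ᵏ` and `Hᵏ`. -/

namespace Burgers

variable {n k : ℕ} {p : ℝ}

/-- The index set, the `γ j` and the coefficient functions are chosen before `u` and `g`; this
uniformity is what makes joint continuity in `(g, u)` accessible. -/
theorem exists_multiDeriv_comp_pull (β : Fin (n + 1) → ℕ) :
    ∃ (ι : Type) (_ : Fintype ι) (γ : ι → Fin (n + 1) → ℕ) (c : ι → G n p → ℝ),
      (∀ j, ∑ i, γ j i = ∑ i, β i) ∧ (∀ j, Continuous (c j)) ∧
      ∀ u : Rd (n + 1) → ℝ, ContDiff ℝ ((∑ i, β i : ℕ) : WithTop ℕ∞) u → ∀ g,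
        multiDeriv β (u ∘ g.pull) = ∑ j, c j g • (multiDeriv (γ j) u ∘ g.pull) := by
  obtain ⟨ι, hι, γ, c, hγ, hc, h⟩ := hasAffineChainRule_multiDeriv β
  refine ⟨ι, hι, γ, fun j g => c j g.mat, hγ, fun j => (hc j).comp G.continuous_mat,
    fun u hu g => ?_⟩
  have e : ∀ w : Rd (n + 1) → ℝ, w ∘ g.pull = fun x => w (affineMap g.mat g.b x) := fun w =>
    funext fun x => congrArg w (g.pull_eq x)
  rw [e, h u hu]
  funext x
  simp [e]

theorem contDiff_pull (g : G n p) {m : WithTop ℕ∞} : ContDiff ℝ m g.pull := by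
  have e : g.pull = affineMap g.mat g.b := funext g.pull_eq
  rw [e]
  exact contDiff_affineMap _ _

theorem act_eq_smul (g : G n p) (u : Rd (n + 1) → ℝ) :
    act g u = (g.α : ℝ)⁻¹ • (u ∘ g.pull) := rfl

theorem contDiff_act (g : G n p) {m : WithTop ℕ∞} {u : Rd (n + 1) → ℝ} (hu : ContDiff ℝ m u) :
    ContDiff ℝ m (act g u) :=
  contDiff_const.mul (hu.comp (contDiff_pull g))

theorem multiDeriv_act_of_comp_pull {β : Fin (n + 1) → ℕ} {ι : Type} [Fintype ι]
    {γ : ι → Fin (n + 1) → ℕ} {c : ι → ℝ} {g : G n p} {u : Rd (n + 1) → ℝ}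
    (h : multiDeriv β (u ∘ g.pull) = ∑ j, c j • (multiDeriv (γ j) u ∘ g.pull)) :
    multiDeriv β (act g u) = ∑ j, c j • act g (multiDeriv (γ j) u) := by
  simp only [act_eq_smul, multiDeriv_smul, h, Finset.smul_sum, smul_comm (c _)]

/-- The action on `C₀ᵏ`. -/
noncomputable def actC0 (g : G n p) : C0 (n + 1) k →ₗ[ℝ] C0 (n + 1) k where
  toFun u := by
    refine (⟨act g u, contDiff_act g u.2.1, fun β => ?_⟩ :
      c0Submodule (n + 1) k)
    obtain ⟨ι, _, γ, c, hγ, -, h⟩ := exists_multiDeriv_comp_pull (p := p) β.1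
    rw [multiDeriv_act_of_comp_pull (h u (u.contDiff_multiIndex β) g)]
    have ht := tendsto_finsetSum Finset.univ fun j (_ : j ∈ Finset.univ) =>
      (tendsto_act_cocompact_right (u.2.2 ⟨γ j, (hγ j).le.trans β.2⟩) g).const_smul (c j g)
    simp only [smul_zero, Finset.sum_const_zero] at ht
    refine ht.congr fun x => ?_
    simp
  map_add' u w := Subtype.ext (act_add g u w)
  map_smul' r u := Subtype.ext (act_smul g r u)

theorem coe_actC0 (g : G n p) (u : C0 (n + 1) k) : (actC0 g u : Rd (n + 1) → ℝ) = act g u := rfl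

theorem continuous_C0_deriv (β : MultiIndex (n + 1) k) :
    Continuous fun u : C0 (n + 1) k => u.deriv β :=
  (continuous_apply β).comp (continuous_induced_dom (f := C0.derivs (d := n + 1) (k := k)))

/-- The topology is induced by `derivs`, so each `D^β` may be checked separately; by the chain rule
it is a finite sum built from the order-zero action. -/
theorem continuous_actC0 :
    Continuous fun q : G n p × C0 (n + 1) k => actC0 q.1 q.2 := by
  refine continuous_induced_rng.2 (continuous_pi fun β => ?_)
  obtain ⟨ι, _, γ, c, hγ, hc, h⟩ := exists_multiDeriv_comp_pull (p := p) β.1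
  have e : ∀ q : G n p × C0 (n + 1) k, (actC0 q.1 q.2).deriv β =
      ∑ j, c j q.1 • actZero q.1 (q.2.deriv ⟨γ j, (hγ j).le.trans β.2⟩) := by
    rintro ⟨g, u⟩
    apply DFunLike.coe_injective
    refine (multiDeriv_act_of_comp_pull (h u (u.contDiff_multiIndex β) g)).trans ?_
    funext x
    rw [zeroAtInfty_sum_apply]
    simp only [Finset.sum_apply, Pi.smul_apply]
    rfl
  change Continuous fun q : G n p × C0 (n + 1) k => (actC0 q.1 q.2).deriv β
  simp only [e]
  refine continuous_finsetSum _ fun j _ => ((hc j).comp continuous_fst).smul ?_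
  exact continuous_actZero.comp
    (continuous_fst.prodMk ((continuous_C0_deriv _).comp continuous_snd))

/-- As an inner product the pairing is visibly linear in `f`, so finite sums of `L²` classes come
out without choosing representatives. -/
theorem integral_mul_eq_inner {d : ℕ} (f : Lp ℝ 2 (volume : Measure (Rd d))) {φ : Rd d → ℝ}
    (hφ : MemLp φ 2 volume) : ∫ x, f x * φ x = inner ℝ hφ.toLp f := by
  rw [L2.inner_def]
  refine integral_congr_ae ?_
  filter_upwards [hφ.coeFn_toLp] with x hx
  simp [hx]

theorem integral_actLp_mul_comp_pull (g : G n p) (f : Lp ℝ 2 (volume : Measure (Rd (n + 1))))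
    (φ : Rd (n + 1) → ℝ) :
    ∫ x, actLp g f x * φ (g.pull x) =
      (g.α : ℝ)⁻¹ * ((g.scale ^ (n + 1))⁻¹ * ∫ x, f x * φ x) := by
  rw [← g.integral_comp_pull (fun x => f x * φ x), ← integral_const_mul]
  refine integral_congr_ae ?_
  filter_upwards [coeFn_actLp g f] with x hx
  rw [hx, act_apply, mul_assoc]

/-- The classical chain rule is applied to the test function, not to `u`, so smooth approximation of
`u` is not needed. The coefficients are the classical ones. -/
theorem exists_isWeakDeriv_actLp (β : Fin (n + 1) → ℕ) :
    ∃ (ι : Type) (_ : Fintype ι) (γ : ι → Fin (n + 1) → ℕ) (c : ι → G n p → ℝ),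
      (∀ j, ∑ i, γ j i = ∑ i, β i) ∧ (∀ j, Continuous (c j)) ∧
      ∀ (u : Lp ℝ 2 (volume : Measure (Rd (n + 1))))
        (w : ι → Lp ℝ 2 (volume : Measure (Rd (n + 1)))),
        (∀ j, IsWeakDeriv (γ j) u (w j)) → ∀ g,
          IsWeakDeriv β (actLp g u) (∑ j, c j g • actLp g (w j)) := by
  obtain ⟨ι, hι, γ, c, hγ, hc, h⟩ := exists_multiDeriv_comp_pull (p := p) β
  refine ⟨ι, hι, γ, c, hγ, hc, fun u w hw g φ hφ hs => ?_⟩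
  -- Pulling `φ` back by `g⁻¹` makes it `ψ ∘ g.pull`, so both pairings become integrals against `ψ`
  -- by the same change of variables.
  set ψ : Rd (n + 1) → ℝ := φ ∘ g⁻¹.pull with hψ
  have hψc : ContDiff ℝ ∞ ψ := hφ.comp (contDiff_pull _)
  have hψs : HasCompactSupport ψ := hs.comp_homeomorph g⁻¹.homeo
  have eφ : φ = ψ ∘ g.pull := by
    funext x
    simp [hψ, G.pull_inv_pull]
  have hφm : MemLp φ 2 volume := hφ.continuous.memLp_of_hasCompactSupport hs
  -- Both sides carry the same factor `α⁻¹` and the same Jacobian; the signs agree since `|γ j| =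
  -- |β|`.
  have key : ∀ j, ∫ x, actLp g u x * multiDeriv (γ j) ψ (g.pull x) =
      (-1) ^ (∑ i, β i) * ∫ x, actLp g (w j) x * φ x := by
    intro j
    rw [eφ]
    simp only [Function.comp_apply]
    rw [integral_actLp_mul_comp_pull, integral_actLp_mul_comp_pull, hw j ψ hψc hψs, hγ]
    ring
  have hint : ∀ j, Integrable fun x => actLp g u x * multiDeriv (γ j) ψ (g.pull x) := fun j =>
    Lp_integrable_mul _ ((multiDeriv_continuous (γ j) hψc).comp g.continuous_pull_right)
      ((multiDeriv_hasCompactSupport (γ j) hψs).comp_homeomorph g.homeo)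
  have hD : multiDeriv β φ = ∑ j, c j g • (multiDeriv (γ j) ψ ∘ g.pull) := by
    rw [eφ]
    exact h ψ (hψc.of_le (by exact_mod_cast le_top)) g
  have hL : ∫ x, actLp g u x * multiDeriv β φ x =
      ∑ j, c j g * ∫ x, actLp g u x * multiDeriv (γ j) ψ (g.pull x) := by
    simp only [← integral_const_mul]
    rw [← integral_finsetSum _ fun j _ => (hint j).const_mul _]
    refine integral_congr_ae (Eventually.of_forall fun x => ?_)
    simp only [hD, Finset.sum_apply, Pi.smul_apply, Function.comp_apply, smul_eq_mul,
      Finset.mul_sum]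
    exact Finset.sum_congr rfl fun j _ => by ring
  rw [hL, integral_mul_eq_inner _ hφm, inner_sum, Finset.mul_sum]
  refine Finset.sum_congr rfl fun j _ => ?_
  rw [key, inner_smul_right, ← integral_mul_eq_inner]
  ring

/-- The action on `Hᵏ`. -/
noncomputable def actH (g : G n p) : SobolevH (n + 1) k →ₗ[ℝ] SobolevH (n + 1) k where
  toFun u := by
    refine (⟨actLp g u.1, fun β => ?_⟩ : sobolevSubmodule (n + 1) k)
    obtain ⟨ι, _, γ, c, hγ, -, h⟩ := exists_isWeakDeriv_actLp (p := p) β.1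
    exact ⟨_, h u.1 (fun j => u.deriv ⟨γ j, (hγ j).le.trans β.2⟩)
      (fun j => u.deriv_spec ⟨γ j, (hγ j).le.trans β.2⟩) g⟩
  map_add' u w := Subtype.ext (actLp_add g u.1 w.1)
  map_smul' r u := Subtype.ext (actLp_smul g r u.1)

theorem coe_actH (g : G n p) (u : SobolevH (n + 1) k) : (actH g u).1 = actLp g u.1 := rfl

theorem continuous_SobolevH_deriv (β : MultiIndex (n + 1) k) :
    Continuous fun u : SobolevH (n + 1) k => u.deriv β :=
  (continuous_apply β).comp ((PiLp.continuous_ofLp 2 _).comp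
    (continuous_induced_dom (f := SobolevH.derivs (d := n + 1) (k := k))))

theorem continuous_actH :
    Continuous fun q : G n p × SobolevH (n + 1) k => actH q.1 q.2 := by
  refine continuous_induced_rng.2 ((PiLp.continuous_toLp 2 _).comp (continuous_pi fun β => ?_))
  obtain ⟨ι, _, γ, c, hγ, hc, h⟩ := exists_isWeakDeriv_actLp (p := p) β.1
  have e : ∀ q : G n p × SobolevH (n + 1) k, (actH q.1 q.2).deriv β =
      ∑ j, c j q.1 • actLp q.1 (q.2.deriv ⟨γ j, (hγ j).le.trans β.2⟩) := by
    rintro ⟨g, u⟩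
    -- `deriv` is defined by choice; uniqueness of weak derivatives identifies it with the explicit
    -- sum.
    exact ((actH g u).deriv_spec β).unique (h u.1 _ (fun j => u.deriv_spec ⟨γ j, (hγ j).le.trans β.2⟩) g)
  change Continuous fun q : G n p × SobolevH (n + 1) k => (actH q.1 q.2).deriv β
  simp only [e]
  refine continuous_finsetSum _ fun j _ => ((hc j).comp continuous_fst).smul ?_
  exact continuous_actLp.comp
    (continuous_fst.prodMk ((continuous_SobolevH_deriv _).comp continuous_snd))

end Burgers

theorem lemma3p1 (n k : ℕ) (p : ℝ) (hp : 1 < p) :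
    (∃ a : Burgers.G n p → (C0 (n + 1) k ≃L[ℝ] C0 (n + 1) k),
      (∀ (g : Burgers.G n p) (v : C0 (n + 1) k) (x : Rd (n + 1)), a g v x = Burgers.act g v x) ∧
      a 1 = ContinuousLinearEquiv.refl ℝ (C0 (n + 1) k) ∧
      (∀ (g h : Burgers.G n p) (v : C0 (n + 1) k), a (g * h) v = a g (a h v)) ∧
      (∀ v : C0 (n + 1) k, Tendsto (fun g : Burgers.G n p => a g v) (𝓝 1) (𝓝 v)) ∧
      Continuous (fun q : Burgers.G n p × C0 (n + 1) k => a q.1 q.2)) ∧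
    (∃ a : Burgers.G n p → (SobolevH (n + 1) k ≃L[ℝ] SobolevH (n + 1) k),
      (∀ (g : Burgers.G n p) (v : SobolevH (n + 1) k),
        (a g v : Rd (n + 1) → ℝ) =ᵐ[volume] Burgers.act g v) ∧
      a 1 = ContinuousLinearEquiv.refl ℝ (SobolevH (n + 1) k) ∧
      (∀ (g h : Burgers.G n p) (v : SobolevH (n + 1) k), a (g * h) v = a g (a h v)) ∧
      (∀ v : SobolevH (n + 1) k, Tendsto (fun g : Burgers.G n p => a g v) (𝓝 1) (𝓝 v)) ∧
      Continuous (fun q : Burgers.G n p × SobolevH (n + 1) k => a q.1 q.2)) := by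
  constructor
  · obtain ⟨a, ha, h⟩ := exists_continuousLinearEquiv_of_continuous
      (Burgers.actC0 (n := n) (k := k) (p := p))
      (fun v => Subtype.ext (Burgers.act_one (v : Rd (n + 1) → ℝ)))
      (fun g h v => Subtype.ext (Burgers.act_mul g h (v : Rd (n + 1) → ℝ)))
      Burgers.continuous_actC0
    exact ⟨a, fun g v x => by rw [ha, Burgers.coe_actC0], h⟩
  · obtain ⟨a, ha, h⟩ := exists_continuousLinearEquiv_of_continuous
      (Burgers.actH (n := n) (k := k) (p := p))
      (fun v => Subtype.ext (Burgers.actLp_one v.1))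
      (fun g h v => Subtype.ext (Burgers.actLp_mul g h v.1))
      Burgers.continuous_actH
    refine ⟨a, fun g v => ?_, h⟩
    rw [ha, Burgers.coe_actH]
    exact Burgers.coeFn_actLp g v.1
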